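/- Let $n\in\mathbb N$, $n\ge 2$, $\alpha\in\mathbb R$, $0<r_1<r_2<\infty$, and let $A_n(r_1,r_2)=\{x\in\mathbb R^n : r_1<|x|<r_2\}$. Let $W_0^{1,2}(A_n(r_1,r_2))$ denote the closure of $C_0^\infty(A_n(r_1,r_2))$ in the Sobolev space $W^{1,2}(A_n(r_1,r_2))$ of (real- or complex-valued) functions in $L^2$ with weak gradient $\nabla f$ in $L^2$. Then for all $f\in W_0^{1,2}(A_n(r_1,r_2))$ both integrals below are finite and $$\int_{A_n(r_1,r_2)} |x|^{\alpha}\,|(\nabla f)(x)|^2\,d^nx \;\ge\; \left\{\frac{(2-\alpha-n)^2}{4}+\left[\frac{\pi}{\ln(r_2/r_1)}\right]^2\right\}\int_{A_n(r_1,r_2)} |x|^{\alpha-2}\,|f(x)|^2\,d^nx .$$ Moreover, the radial function $$f_{\alpha,r_1,r_2,n}(x)=|x|^{(2-\alpha-n)/2}\,\sin\!\left(\frac{\pi}{\ln(r_2/r_1)}\,\ln(|x|/r_1)\right),\qquad x\in A_n(r_1,r_2),$$ is a nonzero element of $W_0^{1,2}(A_n(r_1,r_2))$ for which equality holds. Hence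 the constant is optimal: no real number $C>\frac{(2-\alpha-n)^2}{4}+\big[\frac{\pi}{\ln(r_2/r_1)}\big]^2$ can replace it in the inequality for all $f\in W_0^{1,2}(A_n(r_1,r_2))$. -/

import Mathlib

open MeasureTheory Filter
open scoped Topology ContDiff

noncomputable section

/-- The open spherical shell `{x ∈ ℝⁿ | r₁ < |x| < r₂}`. -/
def sphericalShell (n : ℕ) (r₁ r₂ : ℝ) : Set (EuclideanSpace ℝ (Fin n)) :=
  {x | r₁ < ‖x‖ ∧ ‖x‖ < r₂}

/-- The classical partial derivative `∂ᵢ φ` of a function on `ℝⁿ`. -/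
def partialDeriv {n : ℕ} {F : Type*} [NormedAddCommGroup F] [NormedSpace ℝ F]
    (i : Fin n) (φ : EuclideanSpace ℝ (Fin n) → F) (x : EuclideanSpace ℝ (Fin n)) : F :=
  fderiv ℝ φ x (EuclideanSpace.single i 1)

/-- The classical gradient `(∂₁ φ, …, ∂ₙ φ)` of a scalar function on `ℝⁿ`, as a vector of `𝕜ⁿ`
with its Euclidean norm. -/
def classicalGradient {n : ℕ} {𝕜 : Type*} [RCLike 𝕜] (φ : EuclideanSpace ℝ (Fin n) → 𝕜)
    (x : EuclideanSpace ℝ (Fin n)) : EuclideanSpace 𝕜 (Fin n) :=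
  WithLp.toLp 2 fun i => partialDeriv i φ x

/-- `φ ∈ C₀^∞(Ω)`: smooth with compact support contained in `Ω`. -/
structure IsTestFunction {n : ℕ} {F : Type*} [NormedAddCommGroup F] [NormedSpace ℝ F]
    (Ω : Set (EuclideanSpace ℝ (Fin n))) (φ : EuclideanSpace ℝ (Fin n) → F) : Prop where
  contDiff : ContDiff ℝ ∞ φ
  hasCompactSupport : HasCompactSupport φ
  tsupport_subset : tsupport φ ⊆ Ω

/-- `G` is the weak (distributional) gradient of `f` on the open set `Ω`. -/
structure HasWeakGradient {n : ℕ} {𝕜 : Type*} [RCLike 𝕜] (Ω : Set (EuclideanSpace ℝ (Fin n)))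
    (f : EuclideanSpace ℝ (Fin n) → 𝕜)
    (G : EuclideanSpace ℝ (Fin n) → EuclideanSpace 𝕜 (Fin n)) : Prop where
  locallyIntegrableOn : LocallyIntegrableOn f Ω
  locallyIntegrableOn_gradient : LocallyIntegrableOn G Ω
  integral_eq : ∀ φ : EuclideanSpace ℝ (Fin n) → ℝ, IsTestFunction Ω φ → ∀ i : Fin n,
    ∫ x in Ω, partialDeriv i φ x • f x = - ∫ x in Ω, φ x • G x i

/-- `f ∈ W₀^{1,2}(Ω)`: `f ∈ L²(Ω)` has a weak gradient in `L²(Ω)`, and `f` is the limit of a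
sequence in `C₀^∞(Ω)` with respect to the norm of `W^{1,2}(Ω)`. -/
def MemW012 {n : ℕ} {𝕜 : Type*} [RCLike 𝕜] (Ω : Set (EuclideanSpace ℝ (Fin n)))
    (f : EuclideanSpace ℝ (Fin n) → 𝕜) : Prop :=
  MemLp f 2 (volume.restrict Ω) ∧
  ∃ G : EuclideanSpace ℝ (Fin n) → EuclideanSpace 𝕜 (Fin n),
    HasWeakGradient Ω f G ∧ MemLp G 2 (volume.restrict Ω) ∧
    ∃ φ : ℕ → EuclideanSpace ℝ (Fin n) → 𝕜, (∀ k, IsTestFunction Ω (φ k)) ∧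
      Tendsto (fun k => eLpNorm (fun x => φ k x - f x) 2 (volume.restrict Ω)) atTop (𝓝 0) ∧
      Tendsto (fun k => eLpNorm (fun x => classicalGradient (φ k) x - G x) 2
        (volume.restrict Ω)) atTop (𝓝 0)

/-- The constant `(2 - α - n)² / 4 + (π / ln(r₂/r₁))²`. -/
def shellHardyConst (n : ℕ) (α r₁ r₂ : ℝ) : ℝ :=
  (2 - α - n) ^ 2 / 4 + (Real.pi / Real.log (r₂ / r₁)) ^ 2

/-- The radial function `r^((2 - α - n)/2) sin((π / ln(r₂/r₁)) ln(r/r₁))`, `r = |x|`. -/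
def shellExtremal (𝕜 : Type*) [RCLike 𝕜] (n : ℕ) (α r₁ r₂ : ℝ)
    (x : EuclideanSpace ℝ (Fin n)) : 𝕜 :=
  ((‖x‖ ^ ((2 - α - n) / 2) *
    Real.sin (Real.pi / Real.log (r₂ / r₁) * Real.log (‖x‖ / r₁)) : ℝ) : 𝕜)

end

/-!
The function `p(r) = r^c sin(κ ln(r/r₁))`, with `c = (2 - α - n)/2` and `κ = π / ln(r₂/r₁)`, is
positive on `(r₁, r₂)`, vanishes at both ends and satisfies Euler's equation
`r² p'' + (n + α - 1) r p' + K p = 0` with `K = c² + κ²`. Hence, for `ψ = p(|x|)`, the vector field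
`V = -|x|^α ∇ψ / ψ` has `div V - |V|² / |x|^α = K |x|^(α-2)`. Integrating this identity against
`|φ|²`, moving the divergence onto the test function `φ` and estimating the result by the
arithmetic-geometric mean inequality gives the inequality on `C₀^∞`, and density gives it on
`W₀^{1,2}`. Equality holds for `ψ`, because in polar coordinates the difference of the two
integrands is the derivative of `r^(n+α-1) p p'`. That `ψ` lies in `W₀^{1,2}` follows by truncating
it smoothly at small heights: its superlevel sets are compact.
-/

section SquareIntegrable

variable {X F : Type*} [MeasurableSpace X] {μ : Measure X} [NormedAddCommGroup F]

theorem tendsto_eLpNorm_zero_of_dominated {p : ENNReal} (hp : p ≠ ⊤) {u : ℕ → X → F} {g : X → ℝ}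
    (hu : ∀ k, AEStronglyMeasurable (u k) μ) (hg : MemLp g p μ)
    (hbound : ∀ k, ∀ᵐ x ∂μ, ‖u k x‖ ≤ g x)
    (hlim : ∀ᵐ x ∂μ, Tendsto (fun k => u k x) atTop (𝓝 0)) :
    Tendsto (fun k => eLpNorm (u k) p μ) atTop (𝓝 0) := by
  rcases eq_or_ne p 0 with rfl | hp0
  · simp only [eLpNorm_exponent_zero, tendsto_const_nhds]
  have hpos : 0 < p.toReal := ENNReal.toReal_pos hp0 hp
  have key : Tendsto (fun k => ∫⁻ x, ‖u k x‖ₑ ^ p.toReal ∂μ) atTop (𝓝 (∫⁻ _, 0 ∂μ)) := by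
    refine tendsto_lintegral_of_dominated_convergence' (fun x => ‖g x‖ₑ ^ p.toReal)
      (fun k => (hu k).enorm.pow_const _) (fun k => ?_) ?_ ?_
    · filter_upwards [hbound k] with x hx
      gcongr
      exact enorm_le_iff_norm_le.2 (hx.trans (le_abs_self _))
    · exact (lintegral_rpow_enorm_lt_top_of_eLpNorm_lt_top hp0 hp hg.eLpNorm_lt_top).ne
    · filter_upwards [hlim] with x hx
      simpa only [enorm_zero, ENNReal.zero_rpow_of_pos hpos] using hx.enorm.ennrpow_const p.toReal
  simpa only [eLpNorm_eq_lintegral_rpow_enorm_toReal hp0 hp, lintegral_zero,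
    ENNReal.zero_rpow_of_pos (one_div_pos.2 hpos)] using key.ennrpow_const (1 / p.toReal)

theorem tendsto_integral_norm_sq {u : ℕ → X → F} {v : X → F} (hu : ∀ k, MemLp (u k) 2 μ)
    (hv : MemLp v 2 μ)
    (hlim : Tendsto (fun k => eLpNorm (fun x => u k x - v x) 2 μ) atTop (𝓝 0)) :
    Tendsto (fun k => ∫ x, ‖u k x‖ ^ 2 ∂μ) atTop (𝓝 (∫ x, ‖v x‖ ^ 2 ∂μ)) := by
  have norm_toLp_sq {w : X → F} (hw : MemLp w 2 μ) : ‖hw.toLp w‖ ^ 2 = ∫ x, ‖w x‖ ^ 2 ∂μ := by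
    rw [Lp.norm_toLp, MemLp.eLpNorm_eq_integral_rpow_norm (by simp) (by simp) hw,
      ENNReal.toReal_ofReal (by positivity), ← Real.rpow_natCast, ← Real.rpow_mul (by positivity)]
    simp
  simpa only [norm_toLp_sq] using
    ((Lp.tendsto_Lp_iff_tendsto_eLpNorm'' u hu v hv).2 hlim).norm.pow 2

theorem tendsto_integral_norm_smul_sq [NormedSpace ℝ F] {u : ℕ → X → F} {v : X → F}
    {w : X → ℝ} {M : ℝ} (hu : ∀ k, MemLp (u k) 2 μ) (hv : MemLp v 2 μ)
    (hw : AEStronglyMeasurable w μ) (hM : ∀ᵐ x ∂μ, ‖w x‖ ≤ M)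
    (hlim : Tendsto (fun k => eLpNorm (fun x => u k x - v x) 2 μ) atTop (𝓝 0)) :
    Tendsto (fun k => ∫ x, ‖w x • u k x‖ ^ 2 ∂μ) atTop (𝓝 (∫ x, ‖w x • v x‖ ^ 2 ∂μ)) := by
  have hbound (g : X → F) : ∀ᵐ x ∂μ, ‖w x • g x‖ ≤ M * ‖g x‖ := by
    filter_upwards [hM] with x hx
    rw [norm_smul]
    gcongr
  have hmem {g : X → F} (hg : MemLp g 2 μ) : MemLp (fun x => w x • g x) 2 μ :=
    hg.of_le_mul (hw.smul hg.1) (hbound g)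
  refine tendsto_integral_norm_sq (fun k => hmem (hu k)) (hmem hv) ?_
  have hupper := ENNReal.Tendsto.const_mul (a := ENNReal.ofReal M) hlim
    (Or.inr ENNReal.ofReal_ne_top)
  rw [mul_zero] at hupper
  refine tendsto_of_tendsto_of_tendsto_of_le_of_le tendsto_const_nhds hupper
    (fun _ => zero_le) fun k => eLpNorm_le_mul_eLpNorm_of_ae_le_mul ?_ 2
  simpa only [smul_sub] using hbound fun x => u k x - v x

end SquareIntegrable

section IntegrationByParts

variable {n : ℕ} {F : Type*} [NormedAddCommGroup F] [NormedSpace ℝ F]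
  {Ω : Set (EuclideanSpace ℝ (Fin n))}

theorem integrable_smul_of_tsupport_subset {u : EuclideanSpace ℝ (Fin n) → ℝ}
    {h : EuclideanSpace ℝ (Fin n) → F} (hu : Continuous u) (hc : HasCompactSupport u)
    (hsub : tsupport u ⊆ Ω) (hh : LocallyIntegrableOn h Ω) :
    Integrable fun x => u x • h x :=
  (integrableOn_iff_integrable_of_support_subset
    ((Function.support_smul_subset_left u h).trans (subset_tsupport u))).1 <|
    (hh.integrableOn_compact_subset hsub hc).continuousOn_smul hu.continuousOn hc

theorem setIntegral_smul_of_tsupport_subset {u : EuclideanSpace ℝ (Fin n) → ℝ}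
    (hsub : tsupport u ⊆ Ω) (h : EuclideanSpace ℝ (Fin n) → F) :
    ∫ x in Ω, u x • h x = ∫ x, u x • h x :=
  setIntegral_eq_integral_of_forall_compl_eq_zero fun x hx => by
    rw [image_eq_zero_of_notMem_tsupport fun hxu => hx (hsub hxu), zero_smul]

theorem tsupport_partialDeriv_subset (i : Fin n) (u : EuclideanSpace ℝ (Fin n) → F) :
    tsupport (partialDeriv i u) ⊆ tsupport u :=
  tsupport_fderiv_apply_subset ℝ _

theorem continuousOn_partialDeriv (hΩ : IsOpen Ω) {h : EuclideanSpace ℝ (Fin n) → F}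
    (hh : ContDiffOn ℝ 1 h Ω) (i : Fin n) : ContinuousOn (partialDeriv i h) Ω :=
  (hh.continuousOn_fderiv_of_isOpen hΩ le_rfl).clm_apply continuousOn_const

theorem integral_partialDeriv_smul (hΩ : IsOpen Ω) {u : EuclideanSpace ℝ (Fin n) → ℝ}
    {h : EuclideanSpace ℝ (Fin n) → F} (hu : ContDiff ℝ 1 u) (hc : HasCompactSupport u)
    (hsub : tsupport u ⊆ Ω) (hh : ContDiffOn ℝ 1 h Ω) (i : Fin n) :
    ∫ x in Ω, partialDeriv i u x • h x = - ∫ x in Ω, u x • partialDeriv i h x := by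
  have hs := tsupport_partialDeriv_subset i u
  have hloc := hh.continuousOn.locallyIntegrableOn hΩ.measurableSet (μ := volume)
  rw [setIntegral_smul_of_tsupport_subset (hs.trans hsub), setIntegral_smul_of_tsupport_subset hsub]
  refine neg_eq_iff_eq_neg.1 (Eq.symm ?_)
  exact integral_smul_fderiv_eq_neg_fderiv_smul_of_integrable
    (integrable_smul_of_tsupport_subset
      ((hu.continuous_fderiv one_ne_zero).clm_apply continuous_const)
      (hc.of_isClosed_subset (isClosed_tsupport _) hs) (hs.trans hsub) hloc)
    (integrable_smul_of_tsupport_subset hu.continuous hc hsub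
      ((continuousOn_partialDeriv hΩ hh i).locallyIntegrableOn hΩ.measurableSet))
    (integrable_smul_of_tsupport_subset hu.continuous hc hsub hloc)
    (fun x _ => hu.differentiable one_ne_zero x)
    fun x hx => (hh.differentiableOn one_ne_zero).differentiableAt (hΩ.mem_nhds (hsub hx))

end IntegrationByParts

section WeakGradient

variable {n : ℕ} {𝕜 : Type*} [RCLike 𝕜] {Ω : Set (EuclideanSpace ℝ (Fin n))}
  {f : EuclideanSpace ℝ (Fin n) → 𝕜} {G G' : EuclideanSpace ℝ (Fin n) → EuclideanSpace 𝕜 (Fin n)}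

theorem continuousOn_classicalGradient (hΩ : IsOpen Ω) (hf : ContDiffOn ℝ 1 f Ω) :
    ContinuousOn (classicalGradient f) Ω :=
  (PiLp.continuous_toLp 2 _).comp_continuousOn
    (continuousOn_pi.2 fun i => continuousOn_partialDeriv hΩ hf i)

theorem hasWeakGradient_classicalGradient (hΩ : IsOpen Ω) (hf : ContDiffOn ℝ 1 f Ω) :
    HasWeakGradient Ω f (classicalGradient f) where
  locallyIntegrableOn := hf.continuousOn.locallyIntegrableOn hΩ.measurableSet
  locallyIntegrableOn_gradient :=
    (continuousOn_classicalGradient hΩ hf).locallyIntegrableOn hΩ.measurableSet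
  integral_eq _ hφ i := integral_partialDeriv_smul hΩ (hφ.contDiff.of_le (by simp))
    hφ.hasCompactSupport hφ.tsupport_subset hf i

theorem HasWeakGradient.locallyIntegrableOn_apply (h : HasWeakGradient Ω f G) (i : Fin n) :
    LocallyIntegrableOn (fun x => G x i) Ω := fun x hx =>
  let ⟨s, hs, hi⟩ := h.locallyIntegrableOn_gradient x hx
  ⟨s, hs, (EuclideanSpace.proj (𝕜 := 𝕜) i).integrable_comp hi⟩

theorem HasWeakGradient.ae_eq (hΩ : IsOpen Ω) (h : HasWeakGradient Ω f G)
    (h' : HasWeakGradient Ω f G') : G =ᵐ[volume.restrict Ω] G' := by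
  have coord_ae_eq (i : Fin n) : ∀ᵐ x, x ∈ Ω → G x i - G' x i = 0 := by
    have hG := h.locallyIntegrableOn_apply i
    have hG' := h'.locallyIntegrableOn_apply i
    refine hΩ.ae_eq_zero_of_integral_contDiff_smul_eq_zero (hG.sub hG') fun φ hφ hc hs => ?_
    have heq : ∫ x, φ x • G x i = ∫ x, φ x • G' x i := by
      rw [← setIntegral_smul_of_tsupport_subset hs, ← setIntegral_smul_of_tsupport_subset hs]
      exact neg_injective <|
        (h.integral_eq φ ⟨hφ, hc, hs⟩ i).symm.trans (h'.integral_eq φ ⟨hφ, hc, hs⟩ i)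
    simp only [smul_sub]
    rw [integral_sub (integrable_smul_of_tsupport_subset hφ.continuous hc hs hG)
      (integrable_smul_of_tsupport_subset hφ.continuous hc hs hG'), heq, sub_self]
  filter_upwards [ae_restrict_mem hΩ.measurableSet,
    ae_restrict_of_ae (ae_all_iff.2 coord_ae_eq)] with x hx hall
  ext i
  exact sub_eq_zero.1 (hall i hx)

theorem HasWeakGradient.integral_mul_norm_sq_eq (hΩ : IsOpen Ω) (h : HasWeakGradient Ω f G)
    (h' : HasWeakGradient Ω f G') (w : EuclideanSpace ℝ (Fin n) → ℝ) :
    ∫ x in Ω, w x * ‖G x‖ ^ 2 = ∫ x in Ω, w x * ‖G' x‖ ^ 2 :=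
  integral_congr_ae <| (h.ae_eq hΩ h').mono fun x hx => by simp only [hx]

theorem MemW012.memLp_of_hasWeakGradient (hΩ : IsOpen Ω) (hf : MemW012 Ω f)
    (hG : HasWeakGradient Ω f G) : MemLp G 2 (volume.restrict Ω) := by
  obtain ⟨-, G', hG', hG'2, -⟩ := hf
  exact hG'2.ae_eq (hG'.ae_eq hΩ hG)

theorem IsTestFunction.memLp (hf : IsTestFunction Ω f) : MemLp f 2 (volume.restrict Ω) :=
  (hf.contDiff.continuous.memLp_of_hasCompactSupport hf.hasCompactSupport).restrict Ω

theorem IsTestFunction.memLp_classicalGradient (hf : IsTestFunction Ω f) :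
    MemLp (classicalGradient f) 2 (volume.restrict Ω) := by
  have hcont : Continuous (classicalGradient f) := continuousOn_univ.1 <|
    continuousOn_classicalGradient isOpen_univ (hf.contDiff.of_le (by simp)).contDiffOn
  refine (hcont.memLp_of_hasCompactSupport ?_).restrict Ω
  refine .intro hf.hasCompactSupport fun x hx => ?_
  ext i
  exact image_eq_zero_of_notMem_tsupport (f := partialDeriv i f) fun h =>
    hx (tsupport_partialDeriv_subset i f h)

end WeakGradient

section ChainRule

variable {n : ℕ} {𝕜 : Type*} [RCLike 𝕜] {f : EuclideanSpace ℝ (Fin n) → ℝ}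
  {x : EuclideanSpace ℝ (Fin n)}

theorem fderiv_apply_eq_sum_smul_partialDeriv {F : Type*} [NormedAddCommGroup F] [NormedSpace ℝ F]
    (φ : EuclideanSpace ℝ (Fin n) → F) (x v : EuclideanSpace ℝ (Fin n)) :
    fderiv ℝ φ x v = ∑ i, v i • partialDeriv i φ x := by
  conv_lhs => rw [← (EuclideanSpace.basisFun (Fin n) ℝ).sum_repr v]
  simp only [EuclideanSpace.basisFun_repr, EuclideanSpace.basisFun_apply, map_sum, map_smul,
    partialDeriv]

theorem norm_fderiv_apply_le (φ : EuclideanSpace ℝ (Fin n) → 𝕜)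
    (x v : EuclideanSpace ℝ (Fin n)) :
    ‖fderiv ℝ φ x v‖ ≤ ‖v‖ * ‖classicalGradient φ x‖ := by
  set v' : EuclideanSpace 𝕜 (Fin n) := WithLp.toLp 2 fun i => (v i : 𝕜) with hv'
  have norm_v' : ‖v'‖ = ‖v‖ := by
    simp only [hv', EuclideanSpace.norm_eq, RCLike.norm_ofReal, Real.norm_eq_abs]
  have h := norm_inner_le_norm (𝕜 := 𝕜) v' (classicalGradient φ x)
  rw [norm_v'] at h
  simpa [fderiv_apply_eq_sum_smul_partialDeriv, PiLp.inner_apply, hv', classicalGradient,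
    RCLike.inner_apply, RCLike.real_smul_eq_coe_mul, mul_comm] using h

theorem partialDeriv_ofReal (hf : DifferentiableAt ℝ f x) (i : Fin n) :
    partialDeriv i (fun y => (f y : 𝕜)) x = ((partialDeriv i f x : ℝ) : 𝕜) := by
  have h : HasFDerivAt (fun y => (f y : 𝕜)) (RCLike.ofRealCLM.comp (fderiv ℝ f x)) x :=
    (RCLike.ofRealCLM (K := 𝕜)).hasFDerivAt.comp x hf.hasFDerivAt
  rw [partialDeriv, h.fderiv]
  rfl

theorem classicalGradient_ofReal_comp {g : ℝ → ℝ} (hg : DifferentiableAt ℝ g (f x))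
    (hf : DifferentiableAt ℝ f x) :
    classicalGradient (fun y => (g (f y) : 𝕜)) x =
      deriv g (f x) • classicalGradient (fun y => (f y : 𝕜)) x := by
  have h := (hg.hasDerivAt.comp_hasFDerivAt x hf.hasFDerivAt).fderiv
  ext i
  simp only [classicalGradient, PiLp.smul_apply]
  rw [partialDeriv_ofReal (f := fun y => g (f y)) (hg.comp x hf), partialDeriv_ofReal hf,
    partialDeriv, show (fun y => g (f y)) = g ∘ f from rfl, h, RCLike.real_smul_eq_coe_mul]
  simp only [smul_apply, smul_eq_mul, RCLike.ofReal_mul, partialDeriv]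

theorem norm_classicalGradient_ofReal (hf : DifferentiableAt ℝ f x) :
    ‖classicalGradient (fun y => (f y : 𝕜)) x‖ = ‖fderiv ℝ f x‖ := by
  rw [← ((InnerProductSpace.toDual ℝ _).symm).norm_map (fderiv ℝ f x), EuclideanSpace.norm_eq,
    EuclideanSpace.norm_eq]
  congr! 3 with i
  change ‖partialDeriv i (fun y => (f y : 𝕜)) x‖ = _
  rw [partialDeriv_ofReal hf, RCLike.norm_ofReal, ← Real.norm_eq_abs,
    ← EuclideanSpace.inner_basisFun_real, InnerProductSpace.toDual_symm_apply,
    EuclideanSpace.basisFun_apply, partialDeriv]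

theorem norm_classicalGradient_radial {p : ℝ → ℝ} (hx : x ≠ 0) (hp : DifferentiableAt ℝ p ‖x‖) :
    ‖classicalGradient (fun y => (p ‖y‖ : 𝕜)) x‖ = |deriv p ‖x‖| := by
  have := nontrivial_of_ne x 0 hx
  have hnorm : DifferentiableAt ℝ (fun y : EuclideanSpace ℝ (Fin n) => ‖y‖) x :=
    (contDiffAt_norm ℝ hx).differentiableAt one_ne_zero
  rw [classicalGradient_ofReal_comp hp hnorm, norm_smul, norm_classicalGradient_ofReal hnorm,
    norm_fderiv_norm hnorm, mul_one, Real.norm_eq_abs]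

theorem fderiv_radial_apply_self {q : ℝ → ℝ} (hx : x ≠ 0) (hq : DifferentiableAt ℝ q ‖x‖) :
    fderiv ℝ (fun y => q ‖y‖) x x = ‖x‖ * deriv q ‖x‖ := by
  have hnorm : DifferentiableAt ℝ (fun y : EuclideanSpace ℝ (Fin n) => ‖y‖) x :=
    (contDiffAt_norm ℝ hx).differentiableAt one_ne_zero
  have h := (hq.hasDerivAt.comp_hasFDerivAt x hnorm.hasFDerivAt).fderiv
  rw [show (fun y => q ‖y‖) = q ∘ fun y => ‖y‖ from rfl, h]
  simp only [smul_apply, smul_eq_mul, hnorm.fderiv_norm_self, mul_comm]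

end ChainRule

noncomputable section Divergence

variable {n : ℕ} {𝕜 : Type*} [RCLike 𝕜] {Ω : Set (EuclideanSpace ℝ (Fin n))}
  {V : EuclideanSpace ℝ (Fin n) → EuclideanSpace ℝ (Fin n)}

/-- The divergence `∑ᵢ ∂ᵢ Vᵢ` of a vector field on `ℝⁿ`, the operator of the divergence theorem
against test functions. -/
def divergence (V : EuclideanSpace ℝ (Fin n) → EuclideanSpace ℝ (Fin n))
    (x : EuclideanSpace ℝ (Fin n)) : ℝ :=
  ∑ i, partialDeriv i (fun y => V y i) x

theorem continuousOn_divergence (hΩ : IsOpen Ω) (hV : ContDiffOn ℝ 1 V Ω) :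
    ContinuousOn (divergence V) Ω :=
  continuousOn_finsetSum _ fun i _ => continuousOn_partialDeriv hΩ (contDiffOn_euclidean.1 hV i) i

theorem divergence_smul_id {a : EuclideanSpace ℝ (Fin n) → ℝ} {x : EuclideanSpace ℝ (Fin n)}
    (ha : DifferentiableAt ℝ a x) :
    divergence (fun y => a y • y) x = n * a x + fderiv ℝ a x x := by
  have hcoord (i : Fin n) :
      partialDeriv i (fun y => a y * y i) x = a x + x i * partialDeriv i a x := by
    have h := ha.hasFDerivAt.mul
      (EuclideanSpace.proj (𝕜 := ℝ) i : EuclideanSpace ℝ (Fin n) →L[ℝ] ℝ).hasFDerivAt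
    rw [partialDeriv, show (fun y => a y * y i) = a * ⇑(EuclideanSpace.proj (𝕜 := ℝ) i) from rfl,
      h.fderiv]
    simp [partialDeriv]
  simp only [divergence, PiLp.smul_apply, smul_eq_mul, hcoord, Finset.sum_add_distrib,
    fderiv_apply_eq_sum_smul_partialDeriv, Finset.sum_const, Finset.card_univ, Fintype.card_fin,
    nsmul_eq_mul]

variable {u : EuclideanSpace ℝ (Fin n) → ℝ}

theorem integrable_partialDeriv_mul_apply (hΩ : IsOpen Ω) (hu : ContDiff ℝ 1 u)
    (hc : HasCompactSupport u) (hsub : tsupport u ⊆ Ω) (hV : ContinuousOn V Ω) (i : Fin n) :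
    Integrable fun x => partialDeriv i u x * V x i := by
  have hs := tsupport_partialDeriv_subset i u
  exact integrable_smul_of_tsupport_subset
    ((hu.continuous_fderiv one_ne_zero).clm_apply continuous_const)
    (hc.of_isClosed_subset (isClosed_tsupport _) hs) (hs.trans hsub)
    (((EuclideanSpace.proj i).continuous.comp_continuousOn hV).locallyIntegrableOn
      hΩ.measurableSet)

theorem integrable_fderiv_apply (hΩ : IsOpen Ω) (hu : ContDiff ℝ 1 u)
    (hc : HasCompactSupport u) (hsub : tsupport u ⊆ Ω) (hV : ContinuousOn V Ω) :
    Integrable fun x => fderiv ℝ u x (V x) := by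
  simp only [fderiv_apply_eq_sum_smul_partialDeriv, smul_eq_mul, mul_comm (V _ _)]
  exact integrable_finsetSum _ fun i _ => integrable_partialDeriv_mul_apply hΩ hu hc hsub hV i

theorem integral_mul_divergence (hΩ : IsOpen Ω) (hu : ContDiff ℝ 1 u)
    (hc : HasCompactSupport u) (hsub : tsupport u ⊆ Ω) (hV : ContDiffOn ℝ 1 V Ω) :
    ∫ x in Ω, u x * divergence V x = - ∫ x in Ω, fderiv ℝ u x (V x) := by
  have hVi := contDiffOn_euclidean.1 hV
  have integrable_mul (i : Fin n) :
      IntegrableOn (fun x => u x * partialDeriv i (fun y => V y i) x) Ω :=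
    (integrable_smul_of_tsupport_subset hu.continuous hc hsub
      ((continuousOn_partialDeriv hΩ (hVi i) i).locallyIntegrableOn hΩ.measurableSet)).integrableOn
  simp only [divergence, Finset.mul_sum, fderiv_apply_eq_sum_smul_partialDeriv, smul_eq_mul,
    mul_comm (V _ _)]
  rw [integral_finsetSum _ fun i _ => integrable_mul i, integral_finsetSum _ fun i _ =>
    (integrable_partialDeriv_mul_apply hΩ hu hc hsub hV.continuousOn i).integrableOn,
    ← Finset.sum_neg_distrib]
  refine Finset.sum_congr rfl fun i _ => ?_
  exact eq_neg_of_add_eq_zero_right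
    (eq_neg_iff_add_eq_zero.1 (integral_partialDeriv_smul hΩ hu hc hsub (hVi i) i))

variable {φ : EuclideanSpace ℝ (Fin n) → 𝕜}

theorem neg_fderiv_norm_sq_apply_le {x : EuclideanSpace ℝ (Fin n)} {w : ℝ} (hw : 0 < w)
    (hφ : DifferentiableAt ℝ φ x) (v : EuclideanSpace ℝ (Fin n)) :
    -fderiv ℝ (fun y => ‖φ y‖ ^ 2) x v ≤
      w * ‖classicalGradient φ x‖ ^ 2 + ‖v‖ ^ 2 / w * ‖φ x‖ ^ 2 := by
  set A := ‖classicalGradient φ x‖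
  calc -fderiv ℝ (fun y => ‖φ y‖ ^ 2) x v
      = 2 * -inner ℝ (φ x) (fderiv ℝ φ x v) := by
        rw [hφ.hasFDerivAt.norm_sq.fderiv]
        simp
    _ ≤ 2 * (‖φ x‖ * (‖v‖ * A)) := by
        gcongr
        exact (neg_le_abs _).trans <| (abs_real_inner_le_norm _ _).trans <|
          mul_le_mul_of_nonneg_left (norm_fderiv_apply_le φ x v) (norm_nonneg _)
    _ = w * A ^ 2 + ‖v‖ ^ 2 / w * ‖φ x‖ ^ 2 - (w * A - ‖v‖ * ‖φ x‖) ^ 2 / w := by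
        field_simp
        ring
    _ ≤ w * A ^ 2 + ‖v‖ ^ 2 / w * ‖φ x‖ ^ 2 := sub_le_self _ (by positivity)

theorem IsTestFunction.norm_sq (hφ : IsTestFunction Ω φ) : IsTestFunction Ω fun x => ‖φ x‖ ^ 2 :=
  have hsub : tsupport (fun x => ‖φ x‖ ^ 2) ⊆ tsupport φ :=
    closure_mono fun x hx h => hx (by simp [h])
  ⟨hφ.contDiff.norm_sq ℝ, hφ.hasCompactSupport.of_isClosed_subset (isClosed_tsupport _) hsub,
    hsub.trans hφ.tsupport_subset⟩

theorem IsTestFunction.integrableOn_mul_norm_sq (hΩ : IsOpen Ω) (hφ : IsTestFunction Ω φ)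
    {b : EuclideanSpace ℝ (Fin n) → ℝ} (hb : ContinuousOn b Ω) :
    IntegrableOn (fun x => b x * ‖φ x‖ ^ 2) Ω := by
  simpa only [smul_eq_mul, mul_comm] using (integrable_smul_of_tsupport_subset
    hφ.norm_sq.contDiff.continuous hφ.norm_sq.hasCompactSupport hφ.norm_sq.tsupport_subset
    (hb.locallyIntegrableOn hΩ.measurableSet)).integrableOn

theorem IsTestFunction.integrableOn_mul_norm_classicalGradient_sq (hΩ : IsOpen Ω)
    (hφ : IsTestFunction Ω φ) {w : EuclideanSpace ℝ (Fin n) → ℝ} (hw : ContinuousOn w Ω) :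
    IntegrableOn (fun x => w x * ‖classicalGradient φ x‖ ^ 2) Ω := by
  have hcoord (i : Fin n) : IsTestFunction Ω (partialDeriv i φ) := by
    have hs := tsupport_partialDeriv_subset i φ
    exact ⟨(hφ.contDiff.fderiv_right (m := ∞) le_rfl).clm_apply contDiff_const,
      hφ.hasCompactSupport.of_isClosed_subset (isClosed_tsupport _) hs,
      hs.trans hφ.tsupport_subset⟩
  simp only [classicalGradient, EuclideanSpace.norm_sq_eq, Finset.mul_sum]
  exact integrable_finsetSum _ fun i _ => (hcoord i).integrableOn_mul_norm_sq hΩ hw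

theorem IsTestFunction.integral_barta_le (hΩ : IsOpen Ω) (hφ : IsTestFunction Ω φ)
    (hV : ContDiffOn ℝ 1 V Ω) {w : EuclideanSpace ℝ (Fin n) → ℝ} (hw : ContinuousOn w Ω)
    (hpos : ∀ x ∈ Ω, 0 < w x) :
    ∫ x in Ω, (divergence V x - ‖V x‖ ^ 2 / w x) * ‖φ x‖ ^ 2 ≤
      ∫ x in Ω, w x * ‖classicalGradient φ x‖ ^ 2 := by
  obtain ⟨hu, hc, hsub⟩ := hφ.norm_sq
  replace hu := hu.of_le (m := 1) (by simp)
  have int_div := hφ.integrableOn_mul_norm_sq hΩ (continuousOn_divergence hΩ hV)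
  have int_sq := hφ.integrableOn_mul_norm_sq hΩ (b := fun x => ‖V x‖ ^ 2 / w x)
    ((hV.continuousOn.norm.pow 2).div hw fun x hx => (hpos x hx).ne')
  have int_grad := hφ.integrableOn_mul_norm_classicalGradient_sq hΩ hw
  simp only [sub_mul]
  rw [integral_sub int_div int_sq, sub_le_iff_le_add, ← integral_add int_grad int_sq]
  calc ∫ x in Ω, divergence V x * ‖φ x‖ ^ 2
      = ∫ x in Ω, -fderiv ℝ (fun y => ‖φ y‖ ^ 2) x (V x) := by
        simp only [mul_comm (divergence V _)]
        rw [integral_neg, integral_mul_divergence hΩ hu hc hsub hV]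
    _ ≤ _ := setIntegral_mono_on
        (integrable_fderiv_apply hΩ hu hc hsub hV.continuousOn).integrableOn.neg
        (int_grad.add int_sq) hΩ.measurableSet fun x hx =>
          neg_fderiv_norm_sq_apply_le (hpos x hx) (hφ.contDiff.differentiable (by simp) x) (V x)

end Divergence

noncomputable section Truncation

/-- Truncation at height `1 / c`: a smooth approximation of the identity, as `c → ∞`, by functions
that vanish near the origin. -/
def smoothTrunc (c t : ℝ) : ℝ := t * Real.smoothTransition (c * t - 1)

variable {c t : ℝ}

theorem contDiff_smoothTrunc (c : ℝ) : ContDiff ℝ ∞ (smoothTrunc c) :=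
  contDiff_id.mul (Real.smoothTransition.contDiff.comp
    ((contDiff_const.mul contDiff_id).sub contDiff_const))

theorem smoothTrunc_eq_zero (h : c * t ≤ 1) : smoothTrunc c t = 0 := by
  rw [smoothTrunc, Real.smoothTransition.zero_of_nonpos (by linarith), mul_zero]

theorem smoothTrunc_eq_self (h : 2 ≤ c * t) : smoothTrunc c t = t := by
  rw [smoothTrunc, Real.smoothTransition.one_of_one_le (by linarith), mul_one]

theorem abs_smoothTrunc_sub_self_le (c t : ℝ) : |smoothTrunc c t - t| ≤ |t| := by
  have h0 := Real.smoothTransition.nonneg (c * t - 1)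
  have h1 := Real.smoothTransition.le_one (c * t - 1)
  rw [smoothTrunc, ← mul_sub_one, abs_mul]
  exact mul_le_of_le_one_right (abs_nonneg t) (abs_le.2 ⟨by linarith, by linarith⟩)

theorem deriv_smoothTrunc_eq_one (h : 2 < c * t) : deriv (smoothTrunc c) t = 1 := by
  have heq : smoothTrunc c =ᶠ[𝓝 t] id := by
    filter_upwards [(continuous_const_mul c).continuousAt.eventually (lt_mem_nhds h)] with s hs
      using smoothTrunc_eq_self hs.le
  rw [heq.deriv_eq, deriv_id]

theorem deriv_smoothTrunc (hc : c ≠ 0) (t : ℝ) :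
    deriv (smoothTrunc c) t = deriv (smoothTrunc 1) (c * t) := by
  have hscale : smoothTrunc c = fun s => c⁻¹ * smoothTrunc 1 (c * s) := by
    ext s
    rw [smoothTrunc, smoothTrunc, one_mul, mul_assoc, inv_mul_cancel_left₀ hc]
  rw [hscale, deriv_const_mul_field, deriv_comp_mul_left, smul_eq_mul, inv_mul_cancel_left₀ hc]

theorem exists_abs_deriv_smoothTrunc_le :
    ∃ B : ℝ, ∀ c ≠ 0, ∀ t, |deriv (smoothTrunc c) t| ≤ B := by
  obtain ⟨B, hB⟩ := (isCompact_Icc (a := (1 : ℝ)) (b := 2)).exists_bound_of_continuousOn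
    ((contDiff_smoothTrunc 1).continuous_deriv (by simp)).continuousOn
  refine ⟨max B 1, fun c hc t => ?_⟩
  rw [deriv_smoothTrunc hc]
  generalize c * t = s
  rcases lt_or_ge s 1 with h1 | h1
  · have heq : smoothTrunc 1 =ᶠ[𝓝 s] fun _ => 0 := by
      filter_upwards [gt_mem_nhds h1] with r hr
        using smoothTrunc_eq_zero ((one_mul r).le.trans hr.le)
    rw [heq.deriv_eq, deriv_const, abs_zero]
    exact zero_le_one.trans (le_max_right _ _)
  rcases le_or_gt s 2 with h2 | h2
  · exact (hB s ⟨h1, h2⟩).trans (le_max_left _ _)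
  · rw [deriv_smoothTrunc_eq_one (h2.trans_eq (one_mul s).symm), abs_one]
    exact le_max_right _ _

theorem eventually_two_lt_add_one_mul (ht : 0 < t) : ∀ᶠ k : ℕ in atTop, 2 < (k + 1 : ℝ) * t :=
  ((tendsto_atTop_add_const_right _ 1 tendsto_natCast_atTop_atTop).atTop_mul_const
    ht).eventually_gt_atTop 2

variable {n : ℕ} {𝕜 : Type*} [RCLike 𝕜] {Ω : Set (EuclideanSpace ℝ (Fin n))}
  {f : EuclideanSpace ℝ (Fin n) → ℝ}

theorem isTestFunction_indicator_smoothTrunc (hΩ : IsOpen Ω) (hf : ContDiffOn ℝ ∞ f Ω)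
    (hcompact : ∀ ε > 0, IsCompact {x ∈ Ω | ε ≤ f x}) (hc : 0 < c) :
    IsTestFunction Ω (Ω.indicator fun x => (smoothTrunc c (f x) : 𝕜)) := by
  set φ : EuclideanSpace ℝ (Fin n) → 𝕜 := Ω.indicator fun x => (smoothTrunc c (f x) : 𝕜)
  have hK := hcompact c⁻¹ (inv_pos.2 hc)
  have tsupport_subset : tsupport φ ⊆ {x ∈ Ω | c⁻¹ ≤ f x} := by
    refine closure_minimal (fun x hx => ?_) hK.isClosed
    obtain ⟨hxΩ, hne⟩ := Set.indicator_apply_ne_zero.1 hx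
    refine ⟨hxΩ, le_of_not_gt fun hlt => hne ?_⟩
    have hle : c * f x ≤ 1 := by
      simpa only [mul_inv_cancel₀ hc.ne'] using mul_le_mul_of_nonneg_left hlt.le hc.le
    simp only [smoothTrunc_eq_zero hle, RCLike.ofReal_zero]
  refine ⟨contDiff_iff_contDiffAt.2 fun x => ?_, hK.of_isClosed_subset (isClosed_tsupport _)
    tsupport_subset, fun x hx => (tsupport_subset hx).1⟩
  by_cases hx : x ∈ Ω
  · refine ContDiffAt.congr_of_eventuallyEq ?_ (Set.eqOn_indicator.eventuallyEq_of_mem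
      (hΩ.mem_nhds hx))
    exact (RCLike.ofRealCLM (K := 𝕜)).contDiff.contDiffAt.comp x <|
      (contDiff_smoothTrunc c).contDiffAt.comp x (hf.contDiffAt (hΩ.mem_nhds hx))
  · exact contDiffAt_const.congr_of_eventuallyEq <|
      notMem_tsupport_iff_eventuallyEq.1 fun h => hx (tsupport_subset h).1

theorem classicalGradient_indicator_smoothTrunc (hΩ : IsOpen Ω) (hf : DifferentiableOn ℝ f Ω)
    {x : EuclideanSpace ℝ (Fin n)} (hx : x ∈ Ω) :
    classicalGradient (Ω.indicator fun x => (smoothTrunc c (f x) : 𝕜)) x =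
      deriv (smoothTrunc c) (f x) • classicalGradient (fun x => (f x : 𝕜)) x := by
  rw [← classicalGradient_ofReal_comp ((contDiff_smoothTrunc c).differentiable (by simp) _)
    (hf.differentiableAt (hΩ.mem_nhds hx))]
  have heq : Ω.indicator (fun x => (smoothTrunc c (f x) : 𝕜)) =ᶠ[𝓝 x]
      fun x => (smoothTrunc c (f x) : 𝕜) :=
    Set.eqOn_indicator.eventuallyEq_of_mem (hΩ.mem_nhds hx)
  simp only [classicalGradient, partialDeriv, heq.fderiv_eq]

theorem memW012_of_isCompact_superlevel (hΩ : IsOpen Ω) (hf : ContDiffOn ℝ ∞ f Ω)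
    (hpos : ∀ x ∈ Ω, 0 < f x) (hcompact : ∀ ε > 0, IsCompact {x ∈ Ω | ε ≤ f x})
    (hf2 : MemLp (fun x => (f x : 𝕜)) 2 (volume.restrict Ω))
    (hG2 : MemLp (classicalGradient fun x => (f x : 𝕜)) 2 (volume.restrict Ω)) :
    MemW012 Ω fun x => (f x : 𝕜) := by
  have test (k : ℕ) := isTestFunction_indicator_smoothTrunc (𝕜 := 𝕜) (c := k + 1) hΩ hf hcompact
    (by positivity)
  have hweak : HasWeakGradient Ω (fun x => (f x : 𝕜)) (classicalGradient fun x => (f x : 𝕜)) :=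
    hasWeakGradient_classicalGradient hΩ
      ((RCLike.ofRealCLM (K := 𝕜)).contDiff.comp_contDiffOn (hf.of_le (by simp)))
  refine ⟨hf2, _, hweak, hG2, _, test, ?_, ?_⟩
  · refine tendsto_eLpNorm_zero_of_dominated (by simp) (fun k => (test k).memLp.1.sub hf2.1)
      hf2.norm (fun k => ?_) ?_
    all_goals filter_upwards [ae_restrict_mem hΩ.measurableSet] with x hx
    · rw [Set.indicator_of_mem hx, ← RCLike.ofReal_sub, RCLike.norm_ofReal, RCLike.norm_ofReal]
      exact abs_smoothTrunc_sub_self_le _ _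
    · refine tendsto_const_nhds.congr' ?_
      filter_upwards [eventually_two_lt_add_one_mul (hpos x hx)] with k hk
      rw [Set.indicator_of_mem hx, smoothTrunc_eq_self hk.le, sub_self]
  · obtain ⟨B, hB⟩ := exists_abs_deriv_smoothTrunc_le
    have gradient_sub (k : ℕ) {x} (hx : x ∈ Ω) :
        classicalGradient (Ω.indicator fun x => (smoothTrunc (k + 1) (f x) : 𝕜)) x -
            classicalGradient (fun x => (f x : 𝕜)) x =
          (deriv (smoothTrunc (k + 1)) (f x) - 1) • classicalGradient (fun x => (f x : 𝕜)) x := by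
      rw [classicalGradient_indicator_smoothTrunc hΩ (hf.differentiableOn (by simp)) hx, sub_smul,
        one_smul]
    refine tendsto_eLpNorm_zero_of_dominated (by simp)
      (fun k => (test k).memLp_classicalGradient.1.sub hG2.1) (hG2.norm.const_mul (B + 1))
      (fun k => ?_) ?_
    all_goals filter_upwards [ae_restrict_mem hΩ.measurableSet] with x hx
    · rw [gradient_sub k hx, norm_smul]
      gcongr
      exact (norm_sub_le _ _).trans
        (add_le_add (hB _ (by positivity) _) norm_one.le)
    · refine tendsto_const_nhds.congr' ?_
      filter_upwards [eventually_two_lt_add_one_mul (hpos x hx)] with k hk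
      rw [gradient_sub k hx, deriv_smoothTrunc_eq_one hk, sub_self, zero_smul]

end Truncation

section SphericalShell

variable {n : ℕ} {r₁ r₂ : ℝ}

theorem isOpen_sphericalShell (n : ℕ) (r₁ r₂ : ℝ) : IsOpen (sphericalShell n r₁ r₂) :=
  (isOpen_lt continuous_const continuous_norm).inter (isOpen_lt continuous_norm continuous_const)

theorem measurableSet_sphericalShell (n : ℕ) (r₁ r₂ : ℝ) :
    MeasurableSet (sphericalShell n r₁ r₂) :=
  (isOpen_sphericalShell n r₁ r₂).measurableSet

theorem ne_zero_of_mem_sphericalShell (hr₁ : 0 ≤ r₁) {x : EuclideanSpace ℝ (Fin n)}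
    (hx : x ∈ sphericalShell n r₁ r₂) : x ≠ 0 :=
  norm_pos_iff.1 (hr₁.trans_lt hx.1)

theorem nonempty_sphericalShell [NeZero n] (hr₁ : 0 ≤ r₁) (hr₂ : r₁ < r₂) :
    (sphericalShell n r₁ r₂).Nonempty := by
  obtain ⟨r, h1, h2⟩ := exists_between hr₂
  have hnorm : ‖EuclideanSpace.single (0 : Fin n) r‖ = r := by
    rw [PiLp.norm_single, Real.norm_of_nonneg (hr₁.trans h1.le)]
  exact ⟨EuclideanSpace.single 0 r, h1.trans_eq hnorm.symm, hnorm.trans_lt h2⟩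

instance isFiniteMeasure_restrict_sphericalShell (n : ℕ) (r₁ r₂ : ℝ) :
    IsFiniteMeasure (volume.restrict (sphericalShell n r₁ r₂)) := by
  have hbdd : Bornology.IsBounded (sphericalShell n r₁ r₂) :=
    isBounded_iff_forall_norm_le.2 ⟨r₂, fun _ hx => hx.2.le⟩
  exact ⟨by simpa only [Measure.restrict_apply_univ] using hbdd.measure_lt_top⟩

theorem contDiffOn_radial {F : Type*} [NormedAddCommGroup F] [NormedSpace ℝ F] {p : ℝ → F}
    {m : WithTop ℕ∞} (hr₁ : 0 ≤ r₁) (hp : ContDiffOn ℝ m p (Set.Ioo r₁ r₂)) :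
    ContDiffOn ℝ m (fun x : EuclideanSpace ℝ (Fin n) => p ‖x‖) (sphericalShell n r₁ r₂) :=
  hp.comp (fun _ hx => (contDiffAt_norm ℝ
    (ne_zero_of_mem_sphericalShell hr₁ hx)).contDiffWithinAt) fun _ hx => hx

theorem isCompact_superlevel_radial {p : ℝ → ℝ} (hp : ContinuousOn p (Set.Icc r₁ r₂))
    (h₁ : p r₁ = 0) (h₂ : p r₂ = 0) {ε : ℝ} (hε : 0 < ε) :
    IsCompact {x ∈ sphericalShell n r₁ r₂ | ε ≤ p ‖x‖} := by
  have closed_superlevel : IsClosed (Set.Icc r₁ r₂ ∩ p ⁻¹' Set.Ici ε) :=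
    hp.preimage_isClosed_of_isClosed isClosed_Icc isClosed_Ici
  have heq : {x ∈ sphericalShell n r₁ r₂ | ε ≤ p ‖x‖} =
      norm ⁻¹' (Set.Icc r₁ r₂ ∩ p ⁻¹' Set.Ici ε) := by
    ext x
    refine ⟨fun ⟨hx, hε⟩ => ⟨⟨hx.1.le, hx.2.le⟩, hε⟩, fun ⟨⟨h1, h2⟩, hxε⟩ => ⟨⟨?_, ?_⟩, hxε⟩⟩
    · exact h1.lt_of_ne fun h => (hε.trans_le hxε).ne' (h ▸ h₁)
    · exact h2.lt_of_ne fun h => (hε.trans_le hxε).ne' (h ▸ h₂)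
  rw [heq]
  refine Metric.isCompact_of_isClosed_isBounded (closed_superlevel.preimage continuous_norm) ?_
  exact isBounded_iff_forall_norm_le.2 ⟨r₂, fun x hx => hx.1.2⟩

theorem memLp_of_norm_eq_radial {F : Type*} [NormedAddCommGroup F]
    {u : EuclideanSpace ℝ (Fin n) → F} {g : ℝ → ℝ} (p : ENNReal)
    (hu : ContinuousOn u (sphericalShell n r₁ r₂)) (hg : ContinuousOn g (Set.Icc r₁ r₂))
    (h : ∀ x ∈ sphericalShell n r₁ r₂, ‖u x‖ = |g ‖x‖|) :
    MemLp u p (volume.restrict (sphericalShell n r₁ r₂)) := by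
  obtain ⟨M, hM⟩ := isCompact_Icc.exists_bound_of_continuousOn hg
  have hmeas := measurableSet_sphericalShell n r₁ r₂
  refine .of_bound (hu.aestronglyMeasurable hmeas) M ?_
  filter_upwards [ae_restrict_mem hmeas] with x hx
  exact (h x hx).trans_le (hM ‖x‖ ⟨hx.1.le, hx.2.le⟩)

theorem norm_rpow_le_of_mem_sphericalShell (hr₁ : 0 < r₁) (β : ℝ)
    {x : EuclideanSpace ℝ (Fin n)} (hx : x ∈ sphericalShell n r₁ r₂) :
    ‖x‖ ^ β ≤ r₁ ^ β + r₂ ^ β := by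
  have h0 : 0 < ‖x‖ := hr₁.trans hx.1
  have h2 : 0 < r₂ := h0.trans hx.2
  rcases le_total 0 β with hβ | hβ
  · exact (Real.rpow_le_rpow h0.le hx.2.le hβ).trans
      (le_add_of_nonneg_left (Real.rpow_nonneg hr₁.le β))
  · exact (Real.rpow_le_rpow_of_nonpos hr₁ hx.1.le hβ).trans
      (le_add_of_nonneg_right (Real.rpow_nonneg h2.le β))

theorem norm_rpow_mul_norm_sq {E F : Type*} [NormedAddCommGroup E] [NormedAddCommGroup F]
    [NormedSpace ℝ F] (x : E) (y : F) (β : ℝ) :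
    ‖x‖ ^ β * ‖y‖ ^ 2 = ‖‖x‖ ^ (β / 2) • y‖ ^ 2 := by
  rw [norm_smul, mul_pow, Real.norm_of_nonneg (by positivity),
    ← Real.rpow_mul_natCast (norm_nonneg x), Nat.cast_ofNat, div_mul_cancel₀ β two_ne_zero]

variable {F : Type*} [NormedAddCommGroup F]

theorem integrableOn_norm_rpow_mul_norm_sq (hr₁ : 0 < r₁) (β : ℝ)
    {u : EuclideanSpace ℝ (Fin n) → F}
    (hu : MemLp u 2 (volume.restrict (sphericalShell n r₁ r₂))) :
    IntegrableOn (fun x => ‖x‖ ^ β * ‖u x‖ ^ 2) (sphericalShell n r₁ r₂) := by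
  refine Integrable.bdd_mul (c := r₁ ^ β + r₂ ^ β) ((memLp_two_iff_integrable_sq_norm hu.1).1 hu)
    (measurable_norm.pow_const β).aestronglyMeasurable ?_
  filter_upwards [ae_restrict_mem (measurableSet_sphericalShell n r₁ r₂)] with x hx
  rw [Real.norm_of_nonneg (by positivity)]
  exact norm_rpow_le_of_mem_sphericalShell hr₁ β hx

theorem tendsto_integral_norm_rpow_mul_norm_sq [NormedSpace ℝ F] (hr₁ : 0 < r₁) (β : ℝ)
    {u : ℕ → EuclideanSpace ℝ (Fin n) → F} {v : EuclideanSpace ℝ (Fin n) → F}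
    (hu : ∀ k, MemLp (u k) 2 (volume.restrict (sphericalShell n r₁ r₂)))
    (hv : MemLp v 2 (volume.restrict (sphericalShell n r₁ r₂)))
    (hlim : Tendsto (fun k => eLpNorm (fun x => u k x - v x) 2
      (volume.restrict (sphericalShell n r₁ r₂))) atTop (𝓝 0)) :
    Tendsto (fun k => ∫ x in sphericalShell n r₁ r₂, ‖x‖ ^ β * ‖u k x‖ ^ 2) atTop
      (𝓝 (∫ x in sphericalShell n r₁ r₂, ‖x‖ ^ β * ‖v x‖ ^ 2)) := by
  simp only [norm_rpow_mul_norm_sq]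
  refine tendsto_integral_norm_smul_sq hu hv (M := r₁ ^ (β / 2) + r₂ ^ (β / 2))
    (measurable_norm.pow_const _).aestronglyMeasurable ?_ hlim
  filter_upwards [ae_restrict_mem (measurableSet_sphericalShell n r₁ r₂)] with x hx
  rw [Real.norm_of_nonneg (by positivity)]
  exact norm_rpow_le_of_mem_sphericalShell hr₁ _ hx

theorem integral_norm_rpow_mul_norm_sq_pos [NeZero n] (hr₁ : 0 < r₁) (hr₂ : r₁ < r₂) (β : ℝ)
    {u : EuclideanSpace ℝ (Fin n) → F}
    (hu : MemLp u 2 (volume.restrict (sphericalShell n r₁ r₂)))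
    (hne : ∀ x ∈ sphericalShell n r₁ r₂, u x ≠ 0) :
    0 < ∫ x in sphericalShell n r₁ r₂, ‖x‖ ^ β * ‖u x‖ ^ 2 := by
  rw [setIntegral_pos_iff_support_of_nonneg_ae (.of_forall fun x => by positivity)
    (integrableOn_norm_rpow_mul_norm_sq hr₁ β hu)]
  refine ((isOpen_sphericalShell n r₁ r₂).measure_pos volume
    (nonempty_sphericalShell hr₁.le hr₂)).trans_le (measure_mono fun x hx => ⟨?_, hx⟩)
  have hx0 : 0 < ‖x‖ := hr₁.trans hx.1
  have hu0 : 0 < ‖u x‖ := norm_pos_iff.2 (hne x hx)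
  exact (mul_pos (Real.rpow_pos_of_pos hx0 β) (pow_pos hu0 2)).ne'

theorem setIntegral_sphericalShell_radial [NormedSpace ℝ F] [NeZero n] (hr₁ : 0 ≤ r₁)
    (hr₂ : r₁ ≤ r₂) (g : ℝ → F) :
    ∫ x in sphericalShell n r₁ r₂, g ‖x‖ =
      n • volume.real (Metric.ball (0 : EuclideanSpace ℝ (Fin n)) 1) •
        ∫ r in r₁..r₂, r ^ (n - 1) • g r := by
  have hpolar := integral_fun_norm_addHaar (volume : Measure (EuclideanSpace ℝ (Fin n)))
    ((Set.Ioo r₁ r₂).indicator g)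
  have hshell : ∫ x in sphericalShell n r₁ r₂, g ‖x‖ =
      ∫ x : EuclideanSpace ℝ (Fin n), (Set.Ioo r₁ r₂).indicator g ‖x‖ := by
    rw [← integral_indicator (measurableSet_sphericalShell n r₁ r₂)]
    rfl
  have hinterval : ∫ r in r₁..r₂, r ^ (n - 1) • g r =
      ∫ r in Set.Ioi 0, r ^ (n - 1) • (Set.Ioo r₁ r₂).indicator g r := by
    have hsmul : (fun r => r ^ (n - 1) • (Set.Ioo r₁ r₂).indicator g r) =
        (Set.Ioo r₁ r₂).indicator fun r => r ^ (n - 1) • g r := (Set.indicator_smul _ _ g).symm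
    rw [hsmul, setIntegral_indicator measurableSet_Ioo,
      Set.inter_eq_right.2
      (Set.Ioo_subset_Ioi_self.trans (Set.Ioi_subset_Ioi hr₁)),
      intervalIntegral.integral_of_le hr₂, integral_Ioc_eq_integral_Ioo]
  rw [hshell, hpolar, hinterval, finrank_euclideanSpace_fin]

theorem MemW012.integral_norm_rpow_mul_norm_sq_le {𝕜 : Type*} [RCLike 𝕜]
    {f : EuclideanSpace ℝ (Fin n) → 𝕜} {G : EuclideanSpace ℝ (Fin n) → EuclideanSpace 𝕜 (Fin n)}
    {K α β : ℝ} (hr₁ : 0 < r₁)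
    (htest : ∀ φ : EuclideanSpace ℝ (Fin n) → 𝕜, IsTestFunction (sphericalShell n r₁ r₂) φ →
      K * ∫ x in sphericalShell n r₁ r₂, ‖x‖ ^ β * ‖φ x‖ ^ 2 ≤
        ∫ x in sphericalShell n r₁ r₂, ‖x‖ ^ α * ‖classicalGradient φ x‖ ^ 2)
    (hf : MemW012 (sphericalShell n r₁ r₂) f) (hG : HasWeakGradient (sphericalShell n r₁ r₂) f G) :
    K * ∫ x in sphericalShell n r₁ r₂, ‖x‖ ^ β * ‖f x‖ ^ 2 ≤
      ∫ x in sphericalShell n r₁ r₂, ‖x‖ ^ α * ‖G x‖ ^ 2 := by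
  obtain ⟨hf2, G', hG', hG'2, φ, hφ, hlim, hlimG⟩ := hf
  have lim_left := (tendsto_integral_norm_rpow_mul_norm_sq hr₁ β
    (fun k => (hφ k).memLp) hf2 hlim).const_mul K
  have lim_right := tendsto_integral_norm_rpow_mul_norm_sq hr₁ α
    (fun k => (hφ k).memLp_classicalGradient) hG'2 hlimG
  rw [hG.integral_mul_norm_sq_eq (isOpen_sphericalShell n r₁ r₂) hG']
  exact le_of_tendsto_of_tendsto' lim_left lim_right fun k => htest (φ k) (hφ k)

end SphericalShell

section RadialSobolev

variable {n : ℕ} {𝕜 : Type*} [RCLike 𝕜] {r₁ r₂ : ℝ} {p : ℝ → ℝ}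

theorem contDiffOn_ofReal_radial (hr₁ : 0 ≤ r₁) {m : WithTop ℕ∞}
    (hp : ContDiffOn ℝ m p (Set.Ioi 0)) :
    ContDiffOn ℝ m (fun x : EuclideanSpace ℝ (Fin n) => (p ‖x‖ : 𝕜)) (sphericalShell n r₁ r₂) :=
  contDiffOn_radial hr₁ <| (RCLike.ofRealCLM (K := 𝕜)).contDiff.comp_contDiffOn <|
    hp.mono fun _ hr => hr₁.trans_lt hr.1

theorem norm_classicalGradient_radial_of_mem_sphericalShell (hr₁ : 0 ≤ r₁)
    (hp : ContDiffOn ℝ 1 p (Set.Ioi 0)) {x : EuclideanSpace ℝ (Fin n)}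
    (hx : x ∈ sphericalShell n r₁ r₂) :
    ‖classicalGradient (fun y => (p ‖y‖ : 𝕜)) x‖ = |deriv p ‖x‖| :=
  norm_classicalGradient_radial (ne_zero_of_mem_sphericalShell hr₁ hx) <|
    (hp.differentiableOn one_ne_zero).differentiableAt (Ioi_mem_nhds (hr₁.trans_lt hx.1))

theorem memLp_ofReal_radial (hr₁ : 0 < r₁) (hp : ContDiffOn ℝ 1 p (Set.Ioi 0)) :
    MemLp (fun x => (p ‖x‖ : 𝕜)) 2 (volume.restrict (sphericalShell n r₁ r₂)) :=
  memLp_of_norm_eq_radial 2 (contDiffOn_ofReal_radial hr₁.le hp).continuousOn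
    (hp.continuousOn.mono fun _ hr => hr₁.trans_le hr.1) fun _ _ => RCLike.norm_ofReal _

theorem memLp_classicalGradient_radial (hr₁ : 0 < r₁) (hp : ContDiffOn ℝ 1 p (Set.Ioi 0)) :
    MemLp (classicalGradient fun x => (p ‖x‖ : 𝕜)) 2
      (volume.restrict (sphericalShell n r₁ r₂)) :=
  memLp_of_norm_eq_radial 2
    (continuousOn_classicalGradient (isOpen_sphericalShell n r₁ r₂)
      (contDiffOn_ofReal_radial hr₁.le hp))
    ((hp.continuousOn_deriv_of_isOpen isOpen_Ioi le_rfl).mono fun _ hr => hr₁.trans_le hr.1)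
    fun _ hx => norm_classicalGradient_radial_of_mem_sphericalShell hr₁.le hp hx

theorem memW012_radial (hr₁ : 0 < r₁) (hp : ContDiffOn ℝ ∞ p (Set.Ioi 0))
    (hpos : ∀ r ∈ Set.Ioo r₁ r₂, 0 < p r) (h₁ : p r₁ = 0) (h₂ : p r₂ = 0) :
    MemW012 (sphericalShell n r₁ r₂) fun x => (p ‖x‖ : 𝕜) :=
  have hp1 : ContDiffOn ℝ 1 p (Set.Ioi 0) := hp.of_le (by simp)
  memW012_of_isCompact_superlevel (isOpen_sphericalShell n r₁ r₂)
    (contDiffOn_radial hr₁.le (hp.mono fun _ hr => hr₁.trans hr.1)) (fun x hx => hpos ‖x‖ hx)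
    (fun _ hε => isCompact_superlevel_radial
      (hp.continuousOn.mono fun _ hr => hr₁.trans_le hr.1) h₁ h₂ hε)
    (memLp_ofReal_radial hr₁ hp1) (memLp_classicalGradient_radial hr₁ hp1)

end RadialSobolev

noncomputable section EulerEquation

/-- `p` is a smooth solution of Euler's equation `r² p'' + a r p' + K p = 0` on `(0, ∞)`. For
`a = n + α - 1` this says that `ψ = p(|x|)` solves `-div(|x|^α ∇ψ) = K |x|^(α-2) ψ` on `ℝⁿ ∖ {0}`,
the Euler–Lagrange equation of the weighted inequality with constant `K`. -/
structure IsEulerSolution (a K : ℝ) (p : ℝ → ℝ) : Prop where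
  contDiffOn : ContDiffOn ℝ ∞ p (Set.Ioi 0)
  ode : ∀ r > 0, r ^ 2 * deriv (deriv p) r + a * r * deriv p r + K * p r = 0

/-- The function `q` for which the field `-|x|^α ∇ψ / ψ` of a radial function `ψ = p(|x|)` is
`q(|x|) x`. -/
def logDerivFieldCoeff (α : ℝ) (p : ℝ → ℝ) (r : ℝ) : ℝ := -(r ^ (α - 1) * (deriv p r / p r))

namespace IsEulerSolution

variable {a K : ℝ} {p : ℝ → ℝ} {r r₁ r₂ : ℝ}

theorem contDiffOn_deriv (h : IsEulerSolution a K p) : ContDiffOn ℝ ∞ (deriv p) (Set.Ioi 0) :=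
  h.contDiffOn.deriv_of_isOpen isOpen_Ioi le_rfl

theorem hasDerivAt (h : IsEulerSolution a K p) (hr : 0 < r) : HasDerivAt p (deriv p r) r :=
  ((h.contDiffOn.differentiableOn (by simp)).differentiableAt (Ioi_mem_nhds hr)).hasDerivAt

theorem hasDerivAt_deriv (h : IsEulerSolution a K p) (hr : 0 < r) :
    HasDerivAt (deriv p) (deriv (deriv p) r) r :=
  ((h.contDiffOn_deriv.differentiableOn (by simp)).differentiableAt (Ioi_mem_nhds hr)).hasDerivAt

theorem contDiffOn_logDerivFieldCoeff (h : IsEulerSolution a K p) (hr₁ : 0 ≤ r₁) (α : ℝ)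
    (hpos : ∀ r ∈ Set.Ioo r₁ r₂, 0 < p r) :
    ContDiffOn ℝ ∞ (logDerivFieldCoeff α p) (Set.Ioo r₁ r₂) := by
  have hsub : Set.Ioo r₁ r₂ ⊆ Set.Ioi 0 := fun r hr => hr₁.trans_lt hr.1
  have hrpow : ContDiffOn ℝ ∞ (fun r : ℝ => r ^ (α - 1)) (Set.Ioo r₁ r₂) := fun r hr =>
    (Real.contDiffAt_rpow_const_of_ne (hsub hr).ne').contDiffWithinAt
  exact (hrpow.mul ((h.contDiffOn_deriv.mono hsub).div (h.contDiffOn.mono hsub)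
    fun r hr => (hpos r hr).ne')).neg

theorem riccati {m α : ℝ} (h : IsEulerSolution (m + α - 1) K p) (hr : 0 < r) (hp : p r ≠ 0) :
    m * logDerivFieldCoeff α p r + r * deriv (logDerivFieldCoeff α p) r -
      (logDerivFieldCoeff α p r * r) ^ 2 / r ^ α = K * r ^ (α - 2) := by
  have hq : HasDerivAt (logDerivFieldCoeff α p) (-((α - 1) * r ^ (α - 1 - 1) * (deriv p r / p r) +
      r ^ (α - 1) * ((deriv (deriv p) r * p r - deriv p r * deriv p r) / p r ^ 2))) r :=
    ((Real.hasDerivAt_rpow_const (Or.inl hr.ne')).mul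
      ((h.hasDerivAt_deriv hr).div (h.hasDerivAt hr) hp)).neg
  have hpow : r ^ α ≠ 0 := (Real.rpow_pos_of_pos hr α).ne'
  simp only [hq.deriv, logDerivFieldCoeff, show α - 2 = α - 1 - 1 by ring,
    Real.rpow_sub_one hr.ne']
  field_simp
  linear_combination -(p r) * h.ode r hr

theorem hasDerivAt_rpow_mul_mul_deriv (h : IsEulerSolution a K p) (hr : 0 < r) :
    HasDerivAt (fun s => s ^ a * (p s * deriv p s))
      (r ^ a * deriv p r ^ 2 - K * (r ^ (a - 2) * p r ^ 2)) r := by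
  refine ((Real.hasDerivAt_rpow_const (p := a) (Or.inl hr.ne')).mul
    ((h.hasDerivAt hr).mul (h.hasDerivAt_deriv hr))).congr_deriv ?_
  simp only [Pi.mul_apply, show a - 2 = a - 1 - 1 by ring, Real.rpow_sub_one hr.ne']
  field_simp
  linear_combination p r * h.ode r hr

theorem integral_rpow_mul_deriv_sq (h : IsEulerSolution a K p) (hr₁ : 0 < r₁) (hr₂ : r₁ ≤ r₂)
    (h₁ : p r₁ = 0) (h₂ : p r₂ = 0) :
    ∫ r in r₁..r₂, r ^ a * deriv p r ^ 2 = K * ∫ r in r₁..r₂, r ^ (a - 2) * p r ^ 2 := by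
  have hpos {r : ℝ} (hr : r ∈ Set.uIcc r₁ r₂) : 0 < r := by
    rw [Set.uIcc_of_le hr₂] at hr
    exact hr₁.trans_le hr.1
  have hint (b : ℝ) {g : ℝ → ℝ} (hg : ContDiffOn ℝ ∞ g (Set.Ioi 0)) :
      IntervalIntegrable (fun r => r ^ b * g r ^ 2) volume r₁ r₂ :=
    ContinuousOn.intervalIntegrable <| .mul
      (continuousOn_id.rpow_const fun r hr => Or.inl (hpos hr).ne')
      ((hg.continuousOn.mono fun r hr => hpos hr).pow 2)
  have int_deriv := hint a h.contDiffOn_deriv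
  have int_self := (hint (a - 2) h.contDiffOn).const_mul K
  have hftc := intervalIntegral.integral_eq_sub_of_hasDerivAt
    (fun r hr => h.hasDerivAt_rpow_mul_mul_deriv (hpos hr)) (int_deriv.sub int_self)
  rw [intervalIntegral.integral_sub int_deriv int_self, intervalIntegral.integral_const_mul, h₁, h₂,
    zero_mul, zero_mul, mul_zero, mul_zero, sub_zero] at hftc
  exact sub_eq_zero.1 hftc

variable {n : ℕ} {α : ℝ} {𝕜 : Type*} [RCLike 𝕜]

theorem integral_norm_rpow_mul_norm_sq_le_of_isTestFunction
    (h : IsEulerSolution (n + α - 1) K p) (hr₁ : 0 ≤ r₁)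
    (hpos : ∀ r ∈ Set.Ioo r₁ r₂, 0 < p r) {φ : EuclideanSpace ℝ (Fin n) → 𝕜}
    (hφ : IsTestFunction (sphericalShell n r₁ r₂) φ) :
    K * ∫ x in sphericalShell n r₁ r₂, ‖x‖ ^ (α - 2) * ‖φ x‖ ^ 2 ≤
      ∫ x in sphericalShell n r₁ r₂, ‖x‖ ^ α * ‖classicalGradient φ x‖ ^ 2 := by
  have hΩ := isOpen_sphericalShell n r₁ r₂
  have norm_pos {x : EuclideanSpace ℝ (Fin n)} (hx : x ∈ sphericalShell n r₁ r₂) : 0 < ‖x‖ :=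
    hr₁.trans_lt hx.1
  set q := logDerivFieldCoeff α p
  have hq : ContDiffOn ℝ 1 (fun x : EuclideanSpace ℝ (Fin n) => q ‖x‖) (sphericalShell n r₁ r₂) :=
    contDiffOn_radial hr₁ ((h.contDiffOn_logDerivFieldCoeff hr₁ α hpos).of_le (by simp))
  have hbarta {x : EuclideanSpace ℝ (Fin n)} (hx : x ∈ sphericalShell n r₁ r₂) :
      divergence (fun y => q ‖y‖ • y) x - ‖q ‖x‖ • x‖ ^ 2 / ‖x‖ ^ α = K * ‖x‖ ^ (α - 2) := by
    have hdiff := (hq.differentiableOn one_ne_zero).differentiableAt (hΩ.mem_nhds hx)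
    have hdiffq : DifferentiableAt ℝ q ‖x‖ :=
      ((h.contDiffOn_logDerivFieldCoeff hr₁ α hpos).differentiableOn
        (by simp)).differentiableAt (Ioo_mem_nhds hx.1 hx.2)
    rw [divergence_smul_id hdiff, fderiv_radial_apply_self (norm_pos_iff.1 (norm_pos hx)) hdiffq,
      norm_smul, mul_pow, Real.norm_eq_abs, sq_abs, ← mul_pow]
    exact h.riccati (norm_pos hx) (hpos ‖x‖ hx).ne'
  calc K * ∫ x in sphericalShell n r₁ r₂, ‖x‖ ^ (α - 2) * ‖φ x‖ ^ 2
      = ∫ x in sphericalShell n r₁ r₂,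
          (divergence (fun y => q ‖y‖ • y) x - ‖q ‖x‖ • x‖ ^ 2 / ‖x‖ ^ α) * ‖φ x‖ ^ 2 := by
        rw [← integral_const_mul]
        exact setIntegral_congr_fun hΩ.measurableSet fun x hx => by
          simp only [hbarta hx, mul_assoc]
    _ ≤ _ := hφ.integral_barta_le hΩ (hq.smul contDiffOn_id)
        (continuous_norm.continuousOn.rpow_const fun x hx => Or.inl (norm_pos hx).ne')
        fun x hx => Real.rpow_pos_of_pos (norm_pos hx) α

theorem integral_norm_rpow_mul_norm_classicalGradient_sq [NeZero n]
    (h : IsEulerSolution (n + α - 1) K p) (hr₁ : 0 < r₁) (hr₂ : r₁ ≤ r₂)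
    (h₁ : p r₁ = 0) (h₂ : p r₂ = 0) :
    ∫ x in sphericalShell n r₁ r₂, ‖x‖ ^ α * ‖classicalGradient (fun y => (p ‖y‖ : 𝕜)) x‖ ^ 2 =
      K * ∫ x in sphericalShell n r₁ r₂, ‖x‖ ^ (α - 2) * ‖(p ‖x‖ : 𝕜)‖ ^ 2 := by
  have hgrad : ∫ x in sphericalShell n r₁ r₂,
        ‖x‖ ^ α * ‖classicalGradient (fun y => (p ‖y‖ : 𝕜)) x‖ ^ 2 =
      ∫ x in sphericalShell n r₁ r₂, ‖x‖ ^ α * deriv p ‖x‖ ^ 2 :=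
    setIntegral_congr_fun (measurableSet_sphericalShell n r₁ r₂) fun x hx => by
      simp only [norm_classicalGradient_radial_of_mem_sphericalShell hr₁.le
        (h.contDiffOn.of_le (by simp)) hx, sq_abs]
  have hpolar (β : ℝ) (g : ℝ → ℝ) : ∫ r in r₁..r₂, r ^ (n - 1) • (r ^ β * g r) =
      ∫ r in r₁..r₂, r ^ (n + β - 1) * g r := by
    refine intervalIntegral.integral_congr fun r hr => ?_
    rw [Set.uIcc_of_le hr₂] at hr
    simp only [smul_eq_mul]
    rw [← mul_assoc, ← Real.rpow_natCast, ← Real.rpow_add (hr₁.trans_le hr.1),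
      Nat.cast_pred (NeZero.pos n), sub_add_eq_add_sub]
  rw [hgrad, setIntegral_sphericalShell_radial hr₁.le hr₂ fun r => r ^ α * deriv p r ^ 2]
  simp only [RCLike.norm_ofReal, sq_abs]
  rw [setIntegral_sphericalShell_radial hr₁.le hr₂ fun r => r ^ (α - 2) * p r ^ 2, hpolar α,
    hpolar (α - 2), h.integral_rpow_mul_deriv_sq hr₁ hr₂ h₁ h₂,
    show (n : ℝ) + (α - 2) - 1 = n + α - 1 - 2 by ring]
  simp only [nsmul_eq_mul, smul_eq_mul]
  ring

end IsEulerSolution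

end EulerEquation

noncomputable section ShellProfile

variable {n : ℕ} {α r₁ r₂ r : ℝ}

theorem hasDerivAt_const_mul_log_div (κ : ℝ) (hr₁ : 0 < r₁) (hr : 0 < r) :
    HasDerivAt (fun s => κ * Real.log (s / r₁)) (κ / r) r := by
  refine ((((hasDerivAt_id r).div_const r₁).log (div_pos hr hr₁).ne').const_mul κ).congr_deriv ?_
  simp only [id_eq]
  field_simp

theorem hasDerivAt_rpow_mul_sin_add_cos {θ : ℝ → ℝ} {κ : ℝ} (c A B : ℝ) (hr : 0 < r)
    (hθ : HasDerivAt θ (κ / r) r) :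
    HasDerivAt (fun s => s ^ c * (A * Real.sin (θ s) + B * Real.cos (θ s)))
      (r ^ (c - 1) * ((c * A - κ * B) * Real.sin (θ r) + (c * B + κ * A) * Real.cos (θ r))) r := by
  refine ((Real.hasDerivAt_rpow_const (p := c) (Or.inl hr.ne')).mul
    ((hθ.sin.const_mul A).add (hθ.cos.const_mul B))).congr_deriv ?_
  simp only [Pi.add_apply, Real.rpow_sub_one hr.ne']
  field_simp
  ring

theorem isEulerSolution_rpow_mul_sin (c κ : ℝ) (hr₁ : 0 < r₁) :
    IsEulerSolution (1 - 2 * c) (c ^ 2 + κ ^ 2)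
      fun r => r ^ c * Real.sin (κ * Real.log (r / r₁)) where
  contDiffOn r hr := ((Real.contDiffAt_rpow_const_of_ne hr.ne').mul (contDiffAt_const.mul
    ((contDiffAt_id.div_const r₁).log (div_pos hr hr₁).ne')).sin).contDiffWithinAt
  ode r hr := by
    have hp {s : ℝ} (hs : 0 < s) :
        deriv (fun r => r ^ c * Real.sin (κ * Real.log (r / r₁))) s = s ^ (c - 1) *
          (c * Real.sin (κ * Real.log (s / r₁)) + κ * Real.cos (κ * Real.log (s / r₁))) := by
      simpa using (hasDerivAt_rpow_mul_sin_add_cos c 1 0 hs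
        (hasDerivAt_const_mul_log_div κ hr₁ hs)).deriv
    have hp' := (hasDerivAt_rpow_mul_sin_add_cos (c - 1) c κ hr
      (hasDerivAt_const_mul_log_div κ hr₁ hr)).deriv
    rw [EventuallyEq.deriv_eq ((lt_mem_nhds hr).mono fun _ hs => hp hs), hp', hp hr]
    simp only [Real.rpow_sub_one hr.ne']
    field_simp
    ring

/-- The profile of the extremal function: `shellExtremal 𝕜 n α r₁ r₂` is the radial function with
value `shellProfile n α r₁ r₂ r` at `|x| = r`. -/
def shellProfile (n : ℕ) (α r₁ r₂ r : ℝ) : ℝ :=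
  r ^ ((2 - α - n) / 2) * Real.sin (Real.pi / Real.log (r₂ / r₁) * Real.log (r / r₁))

theorem isEulerSolution_shellProfile (n : ℕ) (α r₂ : ℝ) (hr₁ : 0 < r₁) :
    IsEulerSolution (n + α - 1) (shellHardyConst n α r₁ r₂) (shellProfile n α r₁ r₂) := by
  convert isEulerSolution_rpow_mul_sin ((2 - α - n) / 2) (Real.pi / Real.log (r₂ / r₁)) hr₁ using 1
  · ring
  · rw [shellHardyConst]
    ring
  · rfl

theorem shellProfile_left (hr₁ : 0 < r₁) : shellProfile n α r₁ r₂ r₁ = 0 := by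
  simp [shellProfile, div_self hr₁.ne']

theorem shellProfile_right (hr₁ : 0 < r₁) (hr₂ : r₁ < r₂) : shellProfile n α r₁ r₂ r₂ = 0 := by
  rw [shellProfile, div_mul_cancel₀ _ (Real.log_pos ((one_lt_div hr₁).2 hr₂)).ne', Real.sin_pi,
    mul_zero]

theorem shellProfile_pos (hr₁ : 0 < r₁) (hr : r ∈ Set.Ioo r₁ r₂) :
    0 < shellProfile n α r₁ r₂ r := by
  have hr0 : 0 < r := hr₁.trans hr.1
  have log_pos : 0 < Real.log (r / r₁) := Real.log_pos ((one_lt_div hr₁).2 hr.1)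
  have log_lt : Real.log (r / r₁) < Real.log (r₂ / r₁) :=
    Real.log_lt_log (div_pos hr0 hr₁) (div_lt_div_of_pos_right hr.2 hr₁)
  refine mul_pos (Real.rpow_pos_of_pos hr0 _) (Real.sin_pos_of_pos_of_lt_pi
    (mul_pos (div_pos Real.pi_pos (log_pos.trans log_lt)) log_pos) ?_)
  rw [div_mul_eq_mul_div, div_lt_iff₀ (log_pos.trans log_lt)]
  exact mul_lt_mul_of_pos_left log_lt Real.pi_pos

end ShellProfile

section ShellExtremal

variable {n : ℕ} {𝕜 : Type*} [RCLike 𝕜] {r₁ r₂ : ℝ}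

theorem memW012_shellExtremal (n : ℕ) (α : ℝ) (hr₁ : 0 < r₁) (hr₂ : r₁ < r₂) :
    MemW012 (sphericalShell n r₁ r₂) (shellExtremal 𝕜 n α r₁ r₂) :=
  memW012_radial hr₁ (isEulerSolution_shellProfile n α r₂ hr₁).contDiffOn
    (fun _ hr => shellProfile_pos hr₁ hr) (shellProfile_left hr₁) (shellProfile_right hr₁ hr₂)

theorem integral_shellExtremal_pos [NeZero n] (α : ℝ) (hr₁ : 0 < r₁) (hr₂ : r₁ < r₂) :
    0 < ∫ x in sphericalShell n r₁ r₂, ‖x‖ ^ (α - 2) * ‖shellExtremal 𝕜 n α r₁ r₂ x‖ ^ 2 :=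
  integral_norm_rpow_mul_norm_sq_pos hr₁ hr₂ (α - 2) (memW012_shellExtremal n α hr₁ hr₂).1
    fun _ hx => RCLike.ofReal_ne_zero.2 (shellProfile_pos hr₁ hx).ne'

theorem hasWeakGradient_shellExtremal (n : ℕ) (α r₂ : ℝ) (hr₁ : 0 < r₁) :
    HasWeakGradient (sphericalShell n r₁ r₂) (shellExtremal 𝕜 n α r₁ r₂)
      (classicalGradient (shellExtremal 𝕜 n α r₁ r₂)) :=
  hasWeakGradient_classicalGradient (isOpen_sphericalShell n r₁ r₂) <|
    contDiffOn_ofReal_radial hr₁.le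
      ((isEulerSolution_shellProfile n α r₂ hr₁).contDiffOn.of_le (by simp))

theorem integral_weakGradient_shellExtremal [NeZero n] {α : ℝ} (hr₁ : 0 < r₁) (hr₂ : r₁ < r₂)
    {G : EuclideanSpace ℝ (Fin n) → EuclideanSpace 𝕜 (Fin n)}
    (hG : HasWeakGradient (sphericalShell n r₁ r₂) (shellExtremal 𝕜 n α r₁ r₂) G) :
    ∫ x in sphericalShell n r₁ r₂, ‖x‖ ^ α * ‖G x‖ ^ 2 =
      shellHardyConst n α r₁ r₂ *
        ∫ x in sphericalShell n r₁ r₂, ‖x‖ ^ (α - 2) * ‖shellExtremal 𝕜 n α r₁ r₂ x‖ ^ 2 := by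
  rw [hG.integral_mul_norm_sq_eq (isOpen_sphericalShell n r₁ r₂)
    (hasWeakGradient_shellExtremal n α r₂ hr₁)]
  exact (isEulerSolution_shellProfile n α r₂ hr₁).integral_norm_rpow_mul_norm_classicalGradient_sq
    hr₁ hr₂.le (shellProfile_left hr₁) (shellProfile_right hr₁ hr₂)

end ShellExtremal

theorem theorem2p6_general {𝕜 : Type*} [RCLike 𝕜] (n : ℕ) [NeZero n] (α r₁ r₂ : ℝ)
    (hr₁ : 0 < r₁) (hr₂ : r₁ < r₂) :
    (∀ (f : EuclideanSpace ℝ (Fin n) → 𝕜)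
        (G : EuclideanSpace ℝ (Fin n) → EuclideanSpace 𝕜 (Fin n)),
      MemW012 (sphericalShell n r₁ r₂) f → HasWeakGradient (sphericalShell n r₁ r₂) f G →
        IntegrableOn (fun x => ‖x‖ ^ α * ‖G x‖ ^ 2) (sphericalShell n r₁ r₂) ∧
        IntegrableOn (fun x => ‖x‖ ^ (α - 2) * ‖f x‖ ^ 2) (sphericalShell n r₁ r₂) ∧
        ∫ x in sphericalShell n r₁ r₂, ‖x‖ ^ α * ‖G x‖ ^ 2 ≥
          shellHardyConst n α r₁ r₂ *
            ∫ x in sphericalShell n r₁ r₂, ‖x‖ ^ (α - 2) * ‖f x‖ ^ 2) ∧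
    MemW012 (sphericalShell n r₁ r₂) (shellExtremal 𝕜 n α r₁ r₂) ∧
    0 < ∫ x in sphericalShell n r₁ r₂, ‖x‖ ^ (α - 2) * ‖shellExtremal 𝕜 n α r₁ r₂ x‖ ^ 2 ∧
    (∀ G : EuclideanSpace ℝ (Fin n) → EuclideanSpace 𝕜 (Fin n),
      HasWeakGradient (sphericalShell n r₁ r₂) (shellExtremal 𝕜 n α r₁ r₂) G →
        ∫ x in sphericalShell n r₁ r₂, ‖x‖ ^ α * ‖G x‖ ^ 2 =
          shellHardyConst n α r₁ r₂ *
            ∫ x in sphericalShell n r₁ r₂,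
              ‖x‖ ^ (α - 2) * ‖shellExtremal 𝕜 n α r₁ r₂ x‖ ^ 2) ∧
    (∀ C : ℝ,
      (∀ (f : EuclideanSpace ℝ (Fin n) → 𝕜)
          (G : EuclideanSpace ℝ (Fin n) → EuclideanSpace 𝕜 (Fin n)),
        MemW012 (sphericalShell n r₁ r₂) f → HasWeakGradient (sphericalShell n r₁ r₂) f G →
          ∫ x in sphericalShell n r₁ r₂, ‖x‖ ^ α * ‖G x‖ ^ 2 ≥
            C * ∫ x in sphericalShell n r₁ r₂, ‖x‖ ^ (α - 2) * ‖f x‖ ^ 2) →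
      C ≤ shellHardyConst n α r₁ r₂) := by
  have hψ := memW012_shellExtremal (𝕜 := 𝕜) n α hr₁ hr₂
  have hpos := integral_shellExtremal_pos (n := n) (𝕜 := 𝕜) α hr₁ hr₂
  refine ⟨fun f G hf hG => ⟨?_, ?_, ?_⟩, hψ, hpos,
    fun G hG => integral_weakGradient_shellExtremal hr₁ hr₂ hG, fun C hC => ?_⟩
  · exact integrableOn_norm_rpow_mul_norm_sq hr₁ α
      (hf.memLp_of_hasWeakGradient (isOpen_sphericalShell n r₁ r₂) hG)
  · exact integrableOn_norm_rpow_mul_norm_sq hr₁ (α - 2) hf.1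
  · exact hf.integral_norm_rpow_mul_norm_sq_le hr₁ (fun φ hφ =>
      (isEulerSolution_shellProfile n α r₂ hr₁).integral_norm_rpow_mul_norm_sq_le_of_isTestFunction
        hr₁.le (fun _ hr => shellProfile_pos hr₁ hr) hφ) hG
  · have hG := hasWeakGradient_shellExtremal (𝕜 := 𝕜) n α r₂ hr₁
    have hle := hC _ _ hψ hG
    rw [integral_weakGradient_shellExtremal hr₁ hr₂ hG] at hle
    exact le_of_mul_le_mul_right hle hpos

/-- The weak gradient is unique up to null sets, so quantifying over all weak gradients `G` of `f`
speaks about `∇f`; membership in `W₀^{1,2}` provides one. -/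
theorem theorem2p6 {𝕜 : Type*} [RCLike 𝕜] (n : ℕ) (hn : 2 ≤ n) (α r₁ r₂ : ℝ)
    (hr₁ : 0 < r₁) (hr₂ : r₁ < r₂) :
    -- the inequality, with both integrals finite
    (∀ (f : EuclideanSpace ℝ (Fin n) → 𝕜)
        (G : EuclideanSpace ℝ (Fin n) → EuclideanSpace 𝕜 (Fin n)),
      MemW012 (sphericalShell n r₁ r₂) f → HasWeakGradient (sphericalShell n r₁ r₂) f G →
        IntegrableOn (fun x => ‖x‖ ^ α * ‖G x‖ ^ 2) (sphericalShell n r₁ r₂) ∧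
        IntegrableOn (fun x => ‖x‖ ^ (α - 2) * ‖f x‖ ^ 2) (sphericalShell n r₁ r₂) ∧
        ∫ x in sphericalShell n r₁ r₂, ‖x‖ ^ α * ‖G x‖ ^ 2 ≥
          shellHardyConst n α r₁ r₂ *
            ∫ x in sphericalShell n r₁ r₂, ‖x‖ ^ (α - 2) * ‖f x‖ ^ 2) ∧
    -- the radial function is a nonzero element of `W₀^{1,2}` for which equality holds
    MemW012 (sphericalShell n r₁ r₂) (shellExtremal 𝕜 n α r₁ r₂) ∧
    0 < ∫ x in sphericalShell n r₁ r₂, ‖x‖ ^ (α - 2) * ‖shellExtremal 𝕜 n α r₁ r₂ x‖ ^ 2 ∧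
    (∀ G : EuclideanSpace ℝ (Fin n) → EuclideanSpace 𝕜 (Fin n),
      HasWeakGradient (sphericalShell n r₁ r₂) (shellExtremal 𝕜 n α r₁ r₂) G →
        ∫ x in sphericalShell n r₁ r₂, ‖x‖ ^ α * ‖G x‖ ^ 2 =
          shellHardyConst n α r₁ r₂ *
            ∫ x in sphericalShell n r₁ r₂,
              ‖x‖ ^ (α - 2) * ‖shellExtremal 𝕜 n α r₁ r₂ x‖ ^ 2) ∧
    -- the constant is optimal
    (∀ C : ℝ,
      (∀ (f : EuclideanSpace ℝ (Fin n) → 𝕜)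
          (G : EuclideanSpace ℝ (Fin n) → EuclideanSpace 𝕜 (Fin n)),
        MemW012 (sphericalShell n r₁ r₂) f → HasWeakGradient (sphericalShell n r₁ r₂) f G →
          ∫ x in sphericalShell n r₁ r₂, ‖x‖ ^ α * ‖G x‖ ^ 2 ≥
            C * ∫ x in sphericalShell n r₁ r₂, ‖x‖ ^ (α - 2) * ‖f x‖ ^ 2) →
      C ≤ shellHardyConst n α r₁ r₂) :=
  haveI : NeZero n := ⟨by omega⟩
  theorem2p6_general n α r₁ r₂ hr₁ hr₂
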